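/- Let $\gamma=0.2$, $t_F=3$, $x_0\in(0,1)$, and $$u_0(x)=\begin{cases}1,&x<x_0-\gamma,\\ \tfrac12-\tfrac12\sin\!\big(\tfrac{\pi}{2\gamma}(x-x_0)\big),&|x-x_0|\le\gamma,\\ 0,&x>x_0+\gamma.\end{cases}$$ Write $\check X(t,x)=x+u_0(x)t$ and let $t_1$ be the smallest $t\in[0,t_F]$ for which $\partial_x\check X(t,x)>0$ fails for some $x\in\mathbb R$ (shock formation time). A pair $(u,x_S)$ is called the shock solution of Burgers' equation $u_t+f(u)_x=0$, $f(v)=\tfrac12v^2$, $u(\cdot,0)=u_0$, if: for $0\le t\le t_1$, $u(\cdot,t)$ is continuous on $\mathbb R$ and $u(x,t)=u_0(x-t\,u(x,t))$ for all $x$; for $t_1<t<t_F$ the same holds on $\mathbb R\setminus\{x_S(t)\}$, the one-sided limits $u_L,u_R$ of $u(\cdot,t)$ at $x_S(t)$ from the left and from the right exist with $u_L>u_R$ (entropy condition), and $x_S'(t)=\dfrac{f(u_L)-f(u_R)}{u_L-u_R}$ (Rankine–Hugoniot condition). Put $\Gamma(t)=\{x\in\mathbb R: x_S(t)=\check X(t,x)\}$,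 let $I(t)=(\inf\Gamma(t),\sup\Gamma(t))$ for $t\ge t_1$ and $I(t)=\emptyset$ for $t<t_1$, and define the characteristic maps of the weak solution by $$X(t,x)=\begin{cases}x+u_0(x)t,&x\notin I(t),\\ x_S(t),&x\in I(t).\end{cases}$$ For a subset $\mathcal M$ of a real Hilbert space $V$ let $d(N;\mathcal M)=\inf_{V_N}\sup_{u\in\mathcal M}\inf_{v\in V_N}\|u-v\|$, the first infimum being over all $N$-dimensional subspaces $V_N\subset V$. Say that $\mathcal M$ generates the $2N$-ball $\{\phi_n\}_{n=1}^{2N}$ with coefficients $(a_{nk})$ if the $\phi_n$ are linearly independent and $\phi_n=\sum_{k\ge1}a_{nk}u_{nk}$ (convergent in $V$) with $u_{nk}\in\mathcal M$, $a_{nk}\in\mathbb R$; put $A_{N,1}=\sup_n\sum_k|a_{nk}|$ and $A_{N,p}=\sup_n\big(\sum_kk^p|a_{nk}|^p\big)^{1/p}$ for $1<p<\infty$. For $\alpha>0$, $\mathcal M$ is $\alpha$-sharply convective if for every $p\in[1,\infty)$ there are constants $C$ and $c>0$ such that for every $N\ge1$, $\mathcal M$ generates a $2N$-ball $B_{2N}$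 with $A_{N,p}\le C$, and $B_{2N}$ generates a pairwise orthogonal $2N$-ball $\{\psi_n\}_{n=1}^{2N}$ whose coefficients also satisfy $A'_{N,p}\le C$ and with $\|\psi_n\|\ge cN^{-\alpha}$ for all $n$. **Theorem.** For every $x_0\in(0,1)$ a shock solution exists, and for every shock solution $(u,x_S)$ the family $\mathcal M_B^X=\{X(t,\cdot):t\in(0,t_F)\}\subset L^2(0,1)$ of characteristic maps satisfies $$d(N;\mathcal M_B^X)\ \ge\ c\,N^{-3/2}\qquad\text{for all }N\ge1,$$ with a constant $c>0$ independent of $N$; moreover $\mathcal M_B^X$ is $\tfrac32$-sharply convective. -/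

import Mathlib

noncomputable section

/-! ### Kolmogorov width and sharply convective classes -/

/-- The Kolmogorov `N`-width of a subset `M` of a normed space: the infimum over all
`N`-dimensional subspaces `V` of the worst-case distance from a member of `M` to `V`.
It takes values in `[0, ∞]`. -/
def kolmogorovWidth {E : Type*} [NormedAddCommGroup E] [NormedSpace ℝ E]
    (N : ℕ) (M : Set E) : ENNReal :=
  ⨅ (V : Submodule ℝ E) (_ : FiniteDimensional ℝ V) (_ : Module.finrank ℝ V = N),
    ⨆ u ∈ M, ⨅ v ∈ V, ‖u - v‖ₑ

/-- `M` generates the `2N`-ball `φ 0, …, φ (2N-1)` with coefficients `a`: the `φ n` are linearly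
independent and `φ n = ∑ k, a n k • w n k` for some `w n k ∈ M`.
(The summation index starts at `0` here.) -/
def GeneratesBall {E : Type*} [NormedAddCommGroup E] [NormedSpace ℝ E]
    (M : Set E) (N : ℕ) (φ : Fin (2 * N) → E) (a : Fin (2 * N) → ℕ → ℝ) : Prop :=
  LinearIndependent ℝ φ ∧
    ∃ w : Fin (2 * N) → ℕ → E, (∀ n k, w n k ∈ M) ∧
      ∀ n, HasSum (fun k => a n k • w n k) (φ n)

/-- The number `A_{N,p}` of a coefficient family: `sup_n ∑_k |a_{nk}|` for `p = 1` and
`sup_n (∑_k k^p |a_{nk}|^p)^{1/p}` for `p > 1`, with `k` counted from one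
(so the weight of the coefficient with index `k : ℕ` is `(k + 1)^p`). -/
def ballConstant {N : ℕ} (p : ℝ) (a : Fin (2 * N) → ℕ → ℝ) : ENNReal :=
  if p = 1 then ⨆ n, ∑' k, ENNReal.ofReal |a n k|
  else ⨆ n, (∑' k : ℕ, ENNReal.ofReal (((k : ℝ) + 1) ^ p * |a n k| ^ p)) ^ (1 / p)

/-- `(α, p)`-sharply convective: for every `N ≥ 1` the set generates a `2N`-ball, which in turn
generates an orthogonal `2N`-ball `ψ` with norms at least `c N^{-α}`; both with
`A_{N,p}` bounded uniformly in `N`. -/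
def IsSharplyConvectiveWith {E : Type*} [NormedAddCommGroup E] [InnerProductSpace ℝ E]
    (M : Set E) (α p : ℝ) : Prop :=
  ∃ C c : ℝ, 0 < c ∧ ∀ N : ℕ, 1 ≤ N →
    ∃ (φ : Fin (2 * N) → E) (a : Fin (2 * N) → ℕ → ℝ)
      (ψ : Fin (2 * N) → E) (b : Fin (2 * N) → ℕ → ℝ),
      GeneratesBall M N φ a ∧ ballConstant p a ≤ ENNReal.ofReal C ∧
      GeneratesBall (Set.range φ) N ψ b ∧ ballConstant p b ≤ ENNReal.ofReal C ∧
      (∀ m n, m ≠ n → inner ℝ (ψ m) (ψ n) = 0) ∧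
      ∀ n, c * (N : ℝ) ^ (-α) ≤ ‖ψ n‖

/-- `α`-sharply convective: `(α, p)`-sharply convective for all `p ∈ [1, ∞)`. -/
def IsSharplyConvective {E : Type*} [NormedAddCommGroup E] [InnerProductSpace ℝ E]
    (M : Set E) (α : ℝ) : Prop :=
  ∀ p : ℝ, 1 ≤ p → IsSharplyConvectiveWith M α p

/-! ### The Burgers problem -/

namespace Burgers

/-- The half-width `γ = 0.2` of the transition layer of the initial condition. -/
def γ : ℝ := 0.2

/-- The final time. -/
def tF : ℝ := 3

/-- The flux of Burgers' equation. -/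
def flux (v : ℝ) : ℝ := v ^ 2 / 2

/-- The initial condition, decreasing from `1` to `0` on `[x₀ - γ, x₀ + γ]`. -/
def u0 (x₀ x : ℝ) : ℝ :=
  if x < x₀ - γ then 1
  else if x ≤ x₀ + γ then 1 / 2 - 1 / 2 * Real.sin (Real.pi / (2 * γ) * (x - x₀))
  else 0

/-- The straight characteristic `x + u₀(x) t` issuing from `x`. -/
def Xcheck (x₀ t x : ℝ) : ℝ := x + u0 x₀ x * t

/-- The shock formation time `t₁`: the smallest time in `[0, tF]` at which
`∂ₓ (x + u₀(x) t) > 0` fails for some `x`. -/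
def t1 (x₀ : ℝ) : ℝ :=
  sInf {t | t ∈ Set.Icc 0 tF ∧ ∃ x, deriv (Xcheck x₀ t) x ≤ 0}

/-- `u` (as a function of time and space) is the piecewise smooth weak entropy solution of
Burgers' equation on the line for `0 ≤ t < tF` with initial condition `u₀`, and `xS` is its shock
curve. Up to time `t₁` the solution is continuous in space and constant along the
characteristics; for `t₁ < t < tF` the same holds away from `x = xS t`, where `u` jumps down
(entropy condition) and `xS` moves with the Rankine-Hugoniot speed. -/
structure IsShockSolution (x₀ : ℝ) (u : ℝ → ℝ → ℝ) (xS : ℝ → ℝ) : Prop where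
  continuous_before : ∀ t ∈ Set.Icc 0 (t1 x₀), Continuous (u t)
  char_before : ∀ t ∈ Set.Icc 0 (t1 x₀), ∀ x, u t x = u0 x₀ (x - t * u t x)
  continuous_after : ∀ t ∈ Set.Ioo (t1 x₀) tF, ContinuousOn (u t) {xS t}ᶜ
  char_after : ∀ t ∈ Set.Ioo (t1 x₀) tF, ∀ x, x ≠ xS t → u t x = u0 x₀ (x - t * u t x)
  jump : ∀ t ∈ Set.Ioo (t1 x₀) tF, ∃ uL uR : ℝ,
    Filter.Tendsto (u t) (nhdsWithin (xS t) (Set.Iio (xS t))) (nhds uL) ∧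
    Filter.Tendsto (u t) (nhdsWithin (xS t) (Set.Ioi (xS t))) (nhds uR) ∧
    uR < uL ∧
    HasDerivAt xS ((flux uL - flux uR) / (uL - uR)) t

/-- The set `Γ(t)` of labels whose straight characteristic is at the shock at time `t`. -/
def Γ (x₀ : ℝ) (xS : ℝ → ℝ) (t : ℝ) : Set ℝ := {x | xS t = Xcheck x₀ t x}

/-- The interval `I(t) = (inf Γ(t), sup Γ(t))`, empty before shock formation. -/
def I (x₀ : ℝ) (xS : ℝ → ℝ) (t : ℝ) : Set ℝ :=
  {x | t1 x₀ ≤ t ∧ x ∈ Set.Ioo (sInf (Γ x₀ xS t)) (sSup (Γ x₀ xS t))}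

open Classical in
/-- The characteristic map `X(t, ·)` of the weak solution with shock curve `xS`. -/
def X (x₀ : ℝ) (xS : ℝ → ℝ) (t x : ℝ) : ℝ :=
  if x ∈ I x₀ xS t then xS t else Xcheck x₀ t x

/-- The Hilbert space `L²(0, 1)`. -/
abbrev L2 : Type :=
  MeasureTheory.Lp ℝ 2 (MeasureTheory.volume.restrict (Set.Ioo (0 : ℝ) 1))

/-- The family `{X(t, ·) : t ∈ (0, tF)}` of characteristic maps, as a subset of `L²(0, 1)`. -/
def charFamily (x₀ : ℝ) (xS : ℝ → ℝ) : Set L2 :=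
  {v | ∃ t ∈ Set.Ioo 0 tF,
    ∀ᵐ x ∂(MeasureTheory.volume.restrict (Set.Ioo (0 : ℝ) 1)), v x = X x₀ xS t x}

end Burgers

end

/-! In the frame centred at `x₀ + t / 2` the characteristic with relative label `y` sits at `relChar
t y`, which is odd in `y`. This suggests the shock path `x₀ + t / 2`, and `shock_eq` shows that no
other is possible: the deviation `z` from it satisfies `z * z' ≤ 0` and tends to `0` as `t`
decreases to `t₁`, so `z ^ 2` is nonincreasing with initial limit `0`. A solution with this path is
obtained by inverting `relChar`, globally up to `t₁` and on its outer branches afterwards.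

From time `2 / 5` on, the shock has swallowed the whole transition layer. By `X_eq`, the
characteristic map at time `2 * τ` is then `x + τ` minus the truncation of `x - x₀` to `[-τ, τ]`,
with kinks at `x₀ - τ` and `x₀ + τ`. A second difference in `τ` with step `δ` cancels the affine
part and leaves tents of height `δ` supported in `|(|x - x₀|) - τ| ≤ δ`, of norm at least of order
`δ ^ (3 / 2)`. With `δ` of order `1 / N`, `2N` of them have disjoint supports
(`exists_orthogonal_second_differences`). Their coefficients `1, -2, 1` do not depend on `N`, which
gives sharp convectivity, and by Bessel's inequality no `N`-dimensional space approximates `2N`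
orthogonal vectors well, which gives the width bound. -/

open Set Filter Topology Real MeasureTheory

namespace Burgers

/-! ### The symmetric form of the initial profile and of the characteristics. -/

/-- The odd profile of the initial condition: `u₀ = 1/2 - ramp (x - x₀) / 2`. -/
noncomputable def ramp (y : ℝ) : ℝ :=
  sin (max (-(π / 2)) (min (π / 2) (π / (2 * γ) * y)))

/-- The displacement of the characteristic with label `x₀ + y` relative to `x₀ + t / 2`. -/
noncomputable def relChar (t y : ℝ) : ℝ := y - t / 2 * ramp y

theorem slope_pos : 0 < π / (2 * γ) := by
  unfold γ; positivity

theorem slope_mul_γ : π / (2 * γ) * γ = π / 2 := by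
  unfold γ; ring

theorem γ_pos : 0 < γ := by unfold γ; norm_num

theorem continuous_ramp : Continuous ramp := by unfold ramp; fun_prop

theorem ramp_of_mem {y : ℝ} (h₁ : -γ ≤ y) (h₂ : y ≤ γ) : ramp y = sin (π / (2 * γ) * y) := by
  have h := slope_mul_γ
  have h3 : π / (2 * γ) * y ≤ π / 2 := by rw [← h]; gcongr; exact slope_pos.le
  have h4 : -(π / 2) ≤ π / (2 * γ) * y := by
    rw [← h, ← mul_neg]; gcongr; exact slope_pos.le
  rw [ramp, min_eq_right h3, max_eq_right h4]

theorem ramp_of_ge {y : ℝ} (h₂ : γ ≤ y) : ramp y = 1 := by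
  have h3 : π / 2 ≤ π / (2 * γ) * y := by
    rw [← slope_mul_γ]; gcongr; exact slope_pos.le
  rw [ramp, min_eq_left h3, max_eq_right (by linarith [pi_pos]), sin_pi_div_two]

theorem ramp_neg (y : ℝ) : ramp (-y) = -ramp y := by
  rw [ramp, ramp, ← sin_neg, mul_neg]
  congr 1
  have := pi_pos
  set A := π / (2 * γ) * y
  rcases max_cases (-(π / 2)) (min (π / 2) A) with h | h <;>
  rcases max_cases (-(π / 2)) (min (π / 2) (-A)) with h' | h' <;>
  rcases min_cases (π / 2) A with h'' | h'' <;>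
  rcases min_cases (π / 2) (-A) with h''' | h''' <;> linarith

theorem ramp_of_le {y : ℝ} (h₂ : y ≤ -γ) : ramp y = -1 := by
  have := ramp_neg y
  rw [ramp_of_ge (by linarith)] at this
  linarith

theorem ramp_zero : ramp 0 = 0 := by
  rw [ramp_of_mem (by linarith [γ_pos]) γ_pos.le]; simp

theorem ramp_le_one (y : ℝ) : ramp y ≤ 1 := sin_le_one _

theorem neg_one_le_ramp (y : ℝ) : -1 ≤ ramp y := neg_one_le_sin _

theorem ramp_monotone : Monotone ramp := by
  intro a b hab
  have := pi_pos
  refine sin_le_sin_of_le_of_le_pi_div_two (le_max_left _ _)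
    (max_le (by linarith) (min_le_left _ _)) ?_
  gcongr
  exact slope_pos.le

theorem sin_sub_sin_lt {a b : ℝ} (hab : a < b) : sin b - sin a < b - a := by
  rw [sin_sub_sin]
  have h1 : |sin ((b - a) / 2)| < (b - a) / 2 := by
    have := abs_sin_lt_abs (x := (b - a) / 2) (by linarith)
    rwa [abs_of_pos (by linarith : 0 < (b - a) / 2)] at this
  have h2 : sin ((b - a) / 2) * cos ((b + a) / 2) ≤ |sin ((b - a) / 2)| := by
    calc _ ≤ |sin ((b - a) / 2) * cos ((b + a) / 2)| := le_abs_self _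
      _ = |sin ((b - a) / 2)| * |cos ((b + a) / 2)| := abs_mul _ _
      _ ≤ |sin ((b - a) / 2)| * 1 := by gcongr; exact abs_cos_le_one _
      _ = _ := mul_one _
  linarith

theorem ramp_sub_lt {a b : ℝ} (hab : a < b) : ramp b - ramp a < π / (2 * γ) * (b - a) := by
  have hs := slope_pos
  have hab' : π / (2 * γ) * a < π / (2 * γ) * b := by gcongr
  set A := π / (2 * γ) * a
  set B := π / (2 * γ) * b
  have hcl : max (-(π / 2)) (min (π / 2) B) - max (-(π / 2)) (min (π / 2) A) ≤ B - A := by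
    rcases max_cases (-(π / 2)) (min (π / 2) B) with h | h <;>
    rcases max_cases (-(π / 2)) (min (π / 2) A) with h' | h' <;>
    rcases min_cases (π / 2) B with h'' | h'' <;>
    rcases min_cases (π / 2) A with h''' | h''' <;> linarith
  have hmono : max (-(π / 2)) (min (π / 2) A) ≤ max (-(π / 2)) (min (π / 2) B) := by gcongr
  have hAB : B - A = π / (2 * γ) * (b - a) := by ring
  rw [← hAB]
  rcases hmono.eq_or_lt with h | h
  · have : ramp b - ramp a = 0 := by
      change sin (max (-(π / 2)) (min (π / 2) B)) - sin (max (-(π / 2)) (min (π / 2) A)) = 0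
      rw [h, sub_self]
    linarith
  · exact (sin_sub_sin_lt h).trans_le hcl

/-- The quotient `ramp y / y` is strictly decreasing for `y > 0`: the sine is strictly concave up to
`γ`, and `ramp` is constant beyond. -/
theorem mul_ramp_lt {a b : ℝ} (ha : 0 < a) (hab : a < b) : a * ramp b < b * ramp a := by
  have hg := γ_pos
  have hs := slope_pos
  have key : ∀ b, a < b → b ≤ γ → a * ramp b < b * ramp a := by
    intro b hab hb
    have hb0 : 0 < b := ha.trans hab
    have hm := slope_mul_γ
    have hbπ : π / (2 * γ) * b ≤ π / 2 := by rw [← hm]; gcongr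
    rw [ramp_of_mem (by linarith) hb, ramp_of_mem (by linarith) (by linarith)]
    have h := strictConcaveOn_sin_Icc.2 (left_mem_Icc.2 pi_pos.le)
      (⟨by positivity, by linarith [pi_pos]⟩ : π / (2 * γ) * b ∈ Icc 0 π)
      (by positivity : 0 < π / (2 * γ) * b).ne
      (by rw [sub_pos, div_lt_one hb0]; exact hab : 0 < 1 - a / b)
      (by positivity : 0 < a / b) (by ring)
    simp only [smul_eq_mul, sin_zero, mul_zero, zero_add] at h
    have e : a / b * (π / (2 * γ) * b) = π / (2 * γ) * a := by field_simp
    rw [e, div_mul_eq_mul_div, div_lt_iff₀ hb0] at h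
    linarith
  rcases le_or_gt b γ with hb | hb
  · exact key b hab hb
  · rw [ramp_of_ge hb.le]
    rcases lt_or_ge a γ with ha' | ha'
    · have h := key γ ha' le_rfl
      rw [ramp_of_ge le_rfl] at h
      have hr : 0 < ramp a := by
        by_contra hr
        nlinarith
      nlinarith
    · rw [ramp_of_ge ha']; linarith

theorem u0_eq (x₀ x : ℝ) : u0 x₀ x = 1 / 2 - 1 / 2 * ramp (x - x₀) := by
  unfold u0
  split_ifs with h h'
  · rw [ramp_of_le (by linarith)]; norm_num
  · rw [ramp_of_mem (by linarith) (by linarith)]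
  · rw [ramp_of_ge (by linarith)]; norm_num

theorem Xcheck_eq (x₀ t x : ℝ) : Xcheck x₀ t x = x₀ + t / 2 + relChar t (x - x₀) := by
  rw [Xcheck, u0_eq, relChar]; ring

theorem relChar_neg (t y : ℝ) : relChar t (-y) = -relChar t y := by
  rw [relChar, relChar, ramp_neg]; ring

theorem continuous_relChar (t : ℝ) : Continuous (relChar t) := by
  have := continuous_ramp
  unfold relChar
  fun_prop

/-- Differentiability at the joins `±γ` matters: `t1` tests `deriv ≤ 0`, and `deriv` is `0` by
default at a point of non-differentiability, which would count as a failure. -/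
theorem hasDerivAt_ramp (y : ℝ) : ∃ d, HasDerivAt ramp d y := by
  have hg := γ_pos
  have hsin : ∀ y, HasDerivAt (fun y => sin (π / (2 * γ) * y))
      (cos (π / (2 * γ) * y) * (π / (2 * γ))) y := by
    intro y
    have := ((hasDerivAt_id y).const_mul (π / (2 * γ))).sin
    simpa using this
  have hγ : HasDerivAt ramp 0 γ := by
    have h1 : HasDerivWithinAt ramp 0 (Iic γ) γ := by
      have h := (hsin γ).hasDerivWithinAt (s := Iic γ)
      rw [slope_mul_γ, cos_pi_div_two, zero_mul] at h
      refine h.congr_of_eventuallyEq ?_ (ramp_of_mem (by linarith) le_rfl)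
      filter_upwards [self_mem_nhdsWithin, mem_nhdsWithin_of_mem_nhds (Ioi_mem_nhds hg)]
        with z hz hz'
      exact ramp_of_mem (by have : 0 < z := hz'; linarith) hz
    have h2 : HasDerivWithinAt ramp 0 (Ici γ) γ :=
      (hasDerivWithinAt_const γ (Ici γ) (1 : ℝ)).congr (fun z hz => ramp_of_ge hz)
        (ramp_of_ge le_rfl)
    have := h1.union h2
    rwa [Iic_union_Ici, hasDerivWithinAt_univ] at this
  rcases lt_trichotomy y (-γ) with h | h | h
  · refine ⟨0, (hasDerivAt_const y (-1 : ℝ)).congr_of_eventuallyEq ?_⟩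
    filter_upwards [Iio_mem_nhds h] with z hz using ramp_of_le (le_of_lt hz)
  · subst h
    have e : ramp = fun z => -ramp (-z) := by
      ext z; rw [ramp_neg, neg_neg]
    have h3 : HasDerivAt (fun z : ℝ => -ramp (-z)) (-(0 * -1)) (-γ) := by
      refine (HasDerivAt.comp (-γ) (h₂ := ramp) (h := fun z : ℝ => -z) ?_ (hasDerivAt_neg _)).neg
      rwa [neg_neg]
    rw [← e] at h3
    exact ⟨_, h3⟩
  · rcases lt_trichotomy y γ with h' | h' | h'
    · refine ⟨_, (hsin y).congr_of_eventuallyEq ?_⟩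
      filter_upwards [Ioo_mem_nhds h h'] with z hz using ramp_of_mem hz.1.le hz.2.le
    · subst h'; exact ⟨0, hγ⟩
    · refine ⟨0, (hasDerivAt_const y (1 : ℝ)).congr_of_eventuallyEq ?_⟩
      filter_upwards [Ioi_mem_nhds h'] with z hz using ramp_of_ge (le_of_lt hz)

theorem relChar_sub_ge {t : ℝ} (ht : 0 ≤ t) {a b : ℝ} (hab : a ≤ b) :
    (1 - t / 2 * (π / (2 * γ))) * (b - a) ≤ relChar t b - relChar t a := by
  have h : ramp b - ramp a ≤ π / (2 * γ) * (b - a) := by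
    rcases hab.eq_or_lt with h | h
    · simp [h]
    · exact (ramp_sub_lt h).le
  unfold relChar
  nlinarith [mul_le_mul_of_nonneg_left h (by linarith : 0 ≤ t / 2)]

/-! ### The shock formation time. -/

theorem deriv_Xcheck_ge (x₀ : ℝ) {t : ℝ} (ht : 0 ≤ t) (x : ℝ) :
    1 - t / 2 * (π / (2 * γ)) ≤ deriv (Xcheck x₀ t) x := by
  obtain ⟨d, hd⟩ := hasDerivAt_ramp (x - x₀)
  have hrel : HasDerivAt (fun x => x₀ + t / 2 + relChar t (x - x₀)) (1 - t / 2 * d) x := by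
    have h1 : HasDerivAt (fun x => ramp (x - x₀)) d x := hd.comp_sub_const x x₀
    have := (((hasDerivAt_id x).sub_const x₀).sub (h1.const_mul (t / 2))).const_add (x₀ + t / 2)
    exact this
  have e : Xcheck x₀ t = fun x => x₀ + t / 2 + relChar t (x - x₀) := by
    ext; exact Xcheck_eq _ _ _
  rw [e, hrel.deriv]
  by_contra! hlt
  -- The secant bound `relChar_sub_ge` makes the map monotone after subtraction of a linear
  -- function, so its derivative is bounded below without being computed.
  have hmono : Monotone (fun x => x₀ + t / 2 + relChar t (x - x₀) -
      (1 - t / 2 * (π / (2 * γ))) * x) := by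
    intro a b hab
    have := relChar_sub_ge ht (sub_le_sub_right hab x₀)
    dsimp only
    linarith
  have hD := hrel.sub ((hasDerivAt_id x).const_mul (1 - t / 2 * (π / (2 * γ))))
  have : 0 ≤ deriv (fun x => x₀ + t / 2 + relChar t (x - x₀) -
      (1 - t / 2 * (π / (2 * γ))) * x) x := hmono.deriv_nonneg
  have hD' : HasDerivAt (fun x => x₀ + t / 2 + relChar t (x - x₀) -
      (1 - t / 2 * (π / (2 * γ))) * x) _ x := hD
  rw [hD'.deriv] at this
  linarith

theorem deriv_Xcheck_center (x₀ t : ℝ) :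
    deriv (Xcheck x₀ t) x₀ = 1 - t / 2 * (π / (2 * γ)) := by
  have hg := γ_pos
  have h : HasDerivAt (fun x => x + (1 / 2 - 1 / 2 * sin (π / (2 * γ) * (x - x₀))) * t)
      (1 + (-(1 / 2 * (cos (π / (2 * γ) * (x₀ - x₀)) * (π / (2 * γ) * 1)))) * t) x₀ :=
    (hasDerivAt_id x₀).add ((((((hasDerivAt_id x₀).sub_const x₀).const_mul _).sin.const_mul
      _).const_sub _).mul_const t)
  have h' : HasDerivAt (Xcheck x₀ t)
      (1 + (-(1 / 2 * (cos (π / (2 * γ) * (x₀ - x₀)) * (π / (2 * γ) * 1)))) * t) x₀ := by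
    refine h.congr_of_eventuallyEq ?_
    filter_upwards [Ioo_mem_nhds (by linarith : x₀ - γ < x₀) (by linarith : x₀ < x₀ + γ)]
      with z hz
    rw [Xcheck, u0_eq, ramp_of_mem (by linarith [hz.1]) (by linarith [hz.2])]
  rw [h'.deriv]
  simp
  ring

theorem t1_eq (x₀ : ℝ) : t1 x₀ = 2 / (π / (2 * γ)) := by
  have hs := slope_pos
  have hs' : (2 : ℝ) ≤ π / (2 * γ) := by
    unfold γ; rw [le_div_iff₀ (by norm_num)]; linarith [pi_gt_three]
  refine IsLeast.csInf_eq ⟨⟨⟨by positivity, ?_⟩, x₀, ?_⟩, ?_⟩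
  · rw [div_le_iff₀ hs]; unfold tF; linarith
  · rw [deriv_Xcheck_center]
    apply le_of_eq
    rw [div_right_comm, div_self two_ne_zero, one_div_mul_cancel hs.ne', sub_self]
  · rintro t ⟨⟨ht, -⟩, x, hx⟩
    have := deriv_Xcheck_ge x₀ ht x
    rw [div_le_iff₀ hs]
    linarith

theorem t1_pos (x₀ : ℝ) : 0 < t1 x₀ := by
  have := slope_pos
  rw [t1_eq]; positivity

theorem t1_lt (x₀ : ℝ) : t1 x₀ < 2 / 5 := by
  rw [t1_eq, div_lt_iff₀ slope_pos]
  have : 2 / 5 * (π / (2 * γ)) = π := by unfold γ; ring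
  linarith [pi_gt_three]

theorem t1_lt_iff {x₀ t : ℝ} : t1 x₀ < t ↔ 1 < t / 2 * (π / (2 * γ)) := by
  rw [t1_eq, div_lt_iff₀ slope_pos]
  constructor <;> intro h <;> linarith

theorem u0_mem_Icc (x₀ x : ℝ) : u0 x₀ x ∈ Icc (0 : ℝ) 1 := by
  rw [u0_eq]
  constructor <;> linarith [ramp_le_one (x - x₀), neg_one_le_ramp (x - x₀)]

theorem continuous_u0 (x₀ : ℝ) : Continuous (u0 x₀) := by
  have e : u0 x₀ = fun x => 1 / 2 - 1 / 2 * ramp (x - x₀) := funext (u0_eq x₀)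
  have := continuous_ramp
  rw [e]
  fun_prop

/-! ### Uniqueness of the shock curve and the form of the late characteristic maps. -/

/-- If a value of a solution at `x` is carried by a characteristic, then `x` is recovered from its
relative label. -/
theorem relChar_label {x₀ t x v : ℝ} (h : v = u0 x₀ (x - t * v)) :
    relChar t (x - t * v - x₀) = x - x₀ - t / 2 := by
  rw [u0_eq] at h
  have : ramp (x - t * v - x₀) = 1 - 2 * v := by linarith
  rw [relChar, this]
  ring

/-- Every label to the left of the limiting one is attained at some `x < xS`, by the intermediate
value theorem for the continuous map `x ↦ x - t * u x`. Its characteristic is therefore still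
strictly to the left of the shock. -/
theorem left_limit_label {x₀ t xS uL : ℝ} {u : ℝ → ℝ} (ht : 0 ≤ t)
    (hc : ContinuousOn u (Iio xS)) (hu : ∀ x < xS, u x = u0 x₀ (x - t * u x))
    (hL : Tendsto u (𝓝[<] xS) (𝓝 uL)) :
    uL = u0 x₀ (xS - t * uL) ∧
      ∀ η < xS - t * uL - x₀, relChar t η < relChar t (xS - t * uL - x₀) := by
  have hid : Tendsto (fun x : ℝ => x) (𝓝[<] xS) (𝓝 xS) := tendsto_nhdsWithin_of_tendsto_nhds
    tendsto_id
  have hlab : Tendsto (fun x => x - t * u x) (𝓝[<] xS) (𝓝 (xS - t * uL)) :=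
    hid.sub (hL.const_mul t)
  have hfix : uL = u0 x₀ (xS - t * uL) := by
    refine tendsto_nhds_unique hL ((((continuous_u0 x₀).tendsto _).comp hlab).congr' ?_)
    filter_upwards [self_mem_nhdsWithin] with x hx using (hu x hx).symm
  refine ⟨hfix, fun η hη => ?_⟩
  obtain ⟨b, hb, hbS⟩ : ∃ b, η + x₀ < b - t * u b ∧ b < xS :=
    ((hlab.eventually (lt_mem_nhds (by linarith : η + x₀ < xS - t * uL))).and
      self_mem_nhdsWithin).exists
  -- A point far enough left to have a label below `η + x₀`, since `u ≥ 0`.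
  have ha : min (η + x₀) xS - 1 < xS := by linarith [min_le_right (η + x₀) xS]
  have hua : 0 ≤ t * u (min (η + x₀) xS - 1) := by
    rw [hu _ ha]; exact mul_nonneg ht (u0_mem_Icc _ _).1
  obtain ⟨x, hx, hxη⟩ := isPreconnected_Iio.intermediate_value (s := Iio xS) ha hbS
    (f := fun x => x - t * u x) (continuousOn_id.sub (hc.const_smul t))
    (show η + x₀ ∈ Icc _ _ from ⟨by linarith [min_le_left (η + x₀) xS], hb.le⟩)
  have h1 := relChar_label (hu x hx)
  have h2 := relChar_label hfix
  have hxη' : x - t * u x - x₀ = η := by dsimp only at hxη; linarith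
  rw [hxη'] at h1
  rw [h1, h2]
  have : x < xS := hx
  linarith

theorem right_limit_label {x₀ t xS uR : ℝ} {u : ℝ → ℝ} (ht : 0 ≤ t)
    (hc : ContinuousOn u (Ioi xS)) (hu : ∀ x, xS < x → u x = u0 x₀ (x - t * u x))
    (hR : Tendsto u (𝓝[>] xS) (𝓝 uR)) :
    uR = u0 x₀ (xS - t * uR) ∧
      ∀ η, xS - t * uR - x₀ < η → relChar t (xS - t * uR - x₀) < relChar t η := by
  have hid : Tendsto (fun x : ℝ => x) (𝓝[>] xS) (𝓝 xS) := tendsto_nhdsWithin_of_tendsto_nhds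
    tendsto_id
  have hlab : Tendsto (fun x => x - t * u x) (𝓝[>] xS) (𝓝 (xS - t * uR)) :=
    hid.sub (hR.const_mul t)
  have hfix : uR = u0 x₀ (xS - t * uR) := by
    refine tendsto_nhds_unique hR ((((continuous_u0 x₀).tendsto _).comp hlab).congr' ?_)
    filter_upwards [self_mem_nhdsWithin] with x hx using (hu x hx).symm
  refine ⟨hfix, fun η hη => ?_⟩
  obtain ⟨b, hb, hbS⟩ : ∃ b, b - t * u b < η + x₀ ∧ xS < b :=
    ((hlab.eventually (gt_mem_nhds (by linarith : xS - t * uR < η + x₀))).and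
      self_mem_nhdsWithin).exists
  -- The summand `t` compensates `t * u ≤ t`, so that the label of this point exceeds `η + x₀`.
  have ha : xS < max (η + x₀) xS + t + 1 := by linarith [le_max_right (η + x₀) xS]
  have hua : t * u (max (η + x₀) xS + t + 1) ≤ t := by
    rw [hu _ ha]; exact mul_le_of_le_one_right ht (u0_mem_Icc _ _).2
  obtain ⟨x, hx, hxη⟩ := isPreconnected_Ioi.intermediate_value (s := Ioi xS) hbS ha
    (f := fun x => x - t * u x) (continuousOn_id.sub (hc.const_smul t))
    (show η + x₀ ∈ Icc _ _ from ⟨hb.le, by linarith [le_max_left (η + x₀) xS]⟩)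
  have h1 := relChar_label (hu x hx)
  have h2 := relChar_label hfix
  have hxη' : x - t * u x - x₀ = η := by dsimp only at hxη; linarith
  rw [hxη'] at h1
  rw [h1, h2]
  have : xS < x := hx
  linarith

/-- Two positive labels cannot meet at a position `z ≥ 0`, because `ramp y / y` decreases. Hence `a
≤ 0`, and the slope bound at the centre gives `z ≤ -a * (t / 2 * (π / (2 * γ)) - 1)` with `-a ≤ t /
2 ≤ 3 / 2`. -/
theorem relChar_le_of_two_labels {t a b z : ℝ} (ht : 0 < t) (ht3 : t ≤ 3)
    (hT : 1 ≤ t / 2 * (π / (2 * γ))) (hab : a < b) (ha : relChar t a = z)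
    (hb : relChar t b = z) (hz : 0 ≤ z) : z ≤ 3 / 2 * (t / 2 * (π / (2 * γ)) - 1) := by
  unfold relChar at ha hb
  have ha0 : a ≤ 0 := by
    by_contra! h
    have h1 := mul_ramp_lt h hab
    have h2 : a * z - b * z = t / 2 * (b * ramp a - a * ramp b) := by
      nth_rewrite 1 [← hb]; rw [← ha]; ring
    have h3 : 0 < t / 2 * (b * ramp a - a * ramp b) := by
      apply mul_pos <;> linarith
    nlinarith
  have hr : -ramp a ≤ π / (2 * γ) * (-a) := by
    rcases ha0.eq_or_lt with h | h
    · simp [h, ramp_zero]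
    · have := ramp_sub_lt h
      rw [ramp_zero] at this
      linarith
  have h1 : -a ≤ 3 / 2 := by nlinarith [neg_one_le_ramp a]
  nlinarith [mul_le_mul_of_nonneg_left hr (by linarith : 0 ≤ t / 2)]

namespace IsShockSolution

variable {x₀ : ℝ} {u : ℝ → ℝ → ℝ} {xS : ℝ → ℝ}

/-- The deviation of the shock from the symmetric position is small close to `t₁` and is driven
towards `0`. -/
theorem deviation (h : IsShockSolution x₀ u xS) {t : ℝ} (ht : t ∈ Ioo (t1 x₀) tF) :
    |xS t - x₀ - t / 2| ≤ 3 / 2 * (t / 2 * (π / (2 * γ)) - 1) ∧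
    ∃ d, HasDerivAt (fun s => xS s - x₀ - s / 2) d t ∧ (xS t - x₀ - t / 2) * d ≤ 0 := by
  have ht0 : 0 < t := (t1_pos x₀).trans ht.1
  have hT := t1_lt_iff.1 ht.1
  have ht3 : t ≤ 3 := ht.2.le
  obtain ⟨uL, uR, hL, hR, hlt, hder⟩ := h.jump t ht
  obtain ⟨hfL, hgL⟩ := left_limit_label ht0.le
    ((h.continuous_after t ht).mono fun x hx => (ne_of_lt hx : x ≠ xS t))
    (fun x hx => h.char_after t ht x hx.ne) hL
  obtain ⟨hfR, hgR⟩ := right_limit_label ht0.le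
    ((h.continuous_after t ht).mono fun x hx => (ne_of_gt hx : x ≠ xS t))
    (fun x hx => h.char_after t ht x hx.ne') hR
  have hzL := relChar_label hfL
  have hzR := relChar_label hfR
  rw [u0_eq] at hfL hfR
  have hy : xS t - t * uL - x₀ < xS t - t * uR - x₀ := by
    have := mul_lt_mul_of_pos_left hlt ht0; linarith
  set yL := xS t - t * uL - x₀
  set yR := xS t - t * uR - x₀
  set z := xS t - x₀ - t / 2 with hz
  rw [hzL] at hgL
  rw [hzR] at hgR
  constructor
  · rcases le_total 0 z with hz0 | hz0
    · rw [abs_of_nonneg hz0]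
      exact relChar_le_of_two_labels ht0 ht3 hT.le hy hzL hzR hz0
    · rw [abs_of_nonpos hz0]
      exact relChar_le_of_two_labels ht0 ht3 hT.le (neg_lt_neg hy)
        (by rw [relChar_neg, hzR]) (by rw [relChar_neg, hzL]) (by linarith)
  · refine ⟨_, (hder.sub_const x₀).sub ((hasDerivAt_id t).div_const 2), ?_⟩
    -- The Rankine-Hugoniot speed is the mean of the two states, so the drift relative to speed `1 /
    -- 2` has the sign of `-(ramp yL + ramp yR)`.
    have hspeed : (flux uL - flux uR) / (uL - uR) = (uL + uR) / 2 := by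
      rw [div_eq_iff (by linarith)]; unfold flux; ring
    have hL' : uL = 1 / 2 - 1 / 2 * ramp yL := hfL
    have hR' : uR = 1 / 2 - 1 / 2 * ramp yR := hfR
    have e : (flux uL - flux uR) / (uL - uR) - 1 / 2 = -(ramp yL + ramp yR) / 4 := by
      rw [hspeed, hL', hR']; ring
    rw [e]
    rcases le_total 0 z with hz0 | hz0
    -- Otherwise the characteristic of `-yL`, at position `-z`, would lie strictly to the right of
    -- `z ≥ 0`.
    · have : -yL ≤ yR := by
        by_contra! hc
        have := hgR _ hc
        rw [relChar_neg, hzL] at this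
        linarith
      have := ramp_monotone this
      rw [ramp_neg] at this
      exact mul_nonpos_of_nonneg_of_nonpos hz0 (by linarith)
    · have : yR ≤ -yL := by
        by_contra! hc
        have := hgL (-yR) (by linarith)
        rw [relChar_neg, hzR] at this
        linarith
      have := ramp_monotone this
      rw [ramp_neg] at this
      exact mul_nonpos_of_nonpos_of_nonneg hz0 (by linarith)

/-- The shock curve is uniquely determined. -/
theorem shock_eq (h : IsShockSolution x₀ u xS) {t : ℝ} (ht : t ∈ Ioo (t1 x₀) tF) :
    xS t = x₀ + t / 2 := by
  have hanti : AntitoneOn (fun s => (xS s - x₀ - s / 2) ^ 2) (Ioo (t1 x₀) tF) := by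
    have hd : ∀ s ∈ Ioo (t1 x₀) tF, ∃ d ≤ 0, HasDerivAt (fun s => (xS s - x₀ - s / 2) ^ 2) d s := by
      intro s hs
      obtain ⟨-, d, hd, hle⟩ := h.deviation hs
      refine ⟨_, ?_, hd.pow 2⟩
      simp only [Nat.cast_ofNat, Nat.add_one_sub_one, pow_one]
      nlinarith
    refine antitoneOn_of_deriv_nonpos (convex_Ioo _ _) ?_ ?_ ?_
    · intro s hs
      obtain ⟨d, -, hd⟩ := hd s hs
      exact hd.continuousAt.continuousWithinAt
    · intro s hs
      rw [interior_Ioo] at hs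
      obtain ⟨d, -, hd⟩ := hd s hs
      exact hd.differentiableAt.differentiableWithinAt
    · intro s hs
      rw [interior_Ioo] at hs
      obtain ⟨d, hle, hd⟩ := hd s hs
      rwa [hd.deriv]
  -- Continuity of `xS` at `t₁` is not part of the definition; the bound from `deviation`, which
  -- vanishes at `t₁`, supplies the initial condition.
  have hlim : Tendsto (fun s => (3 / 2 * (s / 2 * (π / (2 * γ)) - 1)) ^ 2) (𝓝[>] (t1 x₀))
      (𝓝 0) := by
    have hc : Continuous (fun s => (3 / 2 * (s / 2 * (π / (2 * γ)) - 1)) ^ 2) := by fun_prop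
    have := hc.tendsto (t1 x₀)
    have e : (3 / 2 * (t1 x₀ / 2 * (π / (2 * γ)) - 1)) ^ 2 = 0 := by
      rw [t1_eq, div_right_comm, div_self two_ne_zero, one_div_mul_cancel slope_pos.ne']
      norm_num
    rw [e] at this
    exact tendsto_nhdsWithin_of_tendsto_nhds this
  have hle : (xS t - x₀ - t / 2) ^ 2 ≤ 0 := by
    refine ge_of_tendsto hlim ?_
    filter_upwards [Ioo_mem_nhdsGT ht.1] with s hs
    have hs' : s ∈ Ioo (t1 x₀) tF := ⟨hs.1, hs.2.trans ht.2⟩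
    calc (xS t - x₀ - t / 2) ^ 2 ≤ (xS s - x₀ - s / 2) ^ 2 := hanti hs' ht hs.2.le
      _ ≤ _ := by
        rw [← sq_abs]
        exact pow_le_pow_left₀ (abs_nonneg _) (h.deviation hs').1 2
  have := pow_eq_zero_iff (two_ne_zero) |>.1 (le_antisymm hle (sq_nonneg _))
  linarith

/-- After the whole transition layer has been absorbed, the characteristic map is affine up to
a truncated identity. -/
theorem X_eq (h : IsShockSolution x₀ u xS) {τ : ℝ} (h₁ : 1 / 5 ≤ τ) (h₂ : τ < 3 / 2) (x : ℝ) :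
    X x₀ xS (2 * τ) x = x + τ - max (-τ) (min τ (x - x₀)) := by
  have ht1 := t1_lt x₀
  have ht : 2 * τ ∈ Ioo (t1 x₀) tF := ⟨by linarith, by unfold tF; linarith⟩
  have hg : γ = 1 / 5 := by unfold γ; norm_num
  have hΓ : ∀ y, y ∈ Γ x₀ xS (2 * τ) ↔ relChar (2 * τ) (y - x₀) = 0 := by
    intro y
    rw [Γ, mem_ofPred_eq, h.shock_eq ht, Xcheck_eq]
    constructor <;> intro h <;> linarith
  -- A zero of `relChar (2 * τ)` satisfies `y = τ * ramp y`, hence `|y| ≤ τ`. Both ends are attained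
  -- because `τ ≥ 1 / 5 = γ`.
  have hsub : Γ x₀ xS (2 * τ) ⊆ Icc (x₀ - τ) (x₀ + τ) := by
    intro y hy
    have := (hΓ y).1 hy
    unfold relChar at this
    constructor <;> nlinarith [ramp_le_one (y - x₀), neg_one_le_ramp (y - x₀)]
  have hinf : sInf (Γ x₀ xS (2 * τ)) = x₀ - τ := by
    refine IsLeast.csInf_eq ⟨(hΓ _).2 ?_, fun y hy => (hsub hy).1⟩
    rw [relChar, ramp_of_le (by linarith)]; ring
  have hsup : sSup (Γ x₀ xS (2 * τ)) = x₀ + τ := by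
    refine IsGreatest.csSup_eq ⟨(hΓ _).2 ?_, fun y hy => (hsub hy).2⟩
    rw [relChar, ramp_of_ge (by linarith)]; ring
  have hI : x ∈ I x₀ xS (2 * τ) ↔ x₀ - τ < x ∧ x < x₀ + τ := by
    rw [I, mem_ofPred_eq, hinf, hsup, mem_Ioo]
    exact and_iff_right ht.1.le
  rw [X]
  split_ifs with hx
  · rw [hI] at hx
    rw [min_eq_right (by linarith), max_eq_right (by linarith), h.shock_eq ht]
    ring
  · rw [hI, not_and_or, not_lt, not_lt] at hx
    rw [Xcheck_eq, relChar]
    rcases hx with hx | hx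
    · rw [min_eq_right (by linarith), max_eq_left (by linarith), ramp_of_le (by linarith)]
      ring
    · rw [min_eq_left (by linarith), max_eq_right (by linarith), ramp_of_ge (by linarith)]
      ring

end IsShockSolution

/-! ### Existence of a shock solution. -/

theorem exists_continuous_rightInverse {h : ℝ → ℝ} (hm : StrictMono h) (hc : Continuous h)
    {C : ℝ} (hC : ∀ y, |h y - y| ≤ C) : ∃ Y : ℝ → ℝ, Continuous Y ∧ ∀ z, h (Y z) = z := by
  have htop : Tendsto h atTop atTop :=
    tendsto_atTop_mono (f := fun y => y - C) (fun y => by linarith [neg_le_of_abs_le (hC y)])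
      (tendsto_atTop_add_const_right _ _ tendsto_id)
  have hbot : Tendsto h atBot atBot :=
    tendsto_atBot_mono (f := fun y => y + C) (fun y => by linarith [le_of_abs_le (hC y)])
      (tendsto_atBot_add_const_right _ _ tendsto_id)
  let e := hm.orderIsoOfSurjective h (hc.surjective htop hbot)
  exact ⟨e.symm, e.symm.continuous, fun z => e.apply_symm_apply z⟩

theorem relChar_strictMono {t : ℝ} (ht : 0 ≤ t) (hT : t / 2 * (π / (2 * γ)) ≤ 1) :
    StrictMono (relChar t) := by
  intro a b hab
  rcases ht.eq_or_lt with rfl | ht0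
  · simpa [relChar] using hab
  · have h1 := mul_lt_mul_of_pos_left (ramp_sub_lt hab) (by linarith : 0 < t / 2)
    unfold relChar
    nlinarith

theorem abs_relChar_sub_le {t : ℝ} (ht : 0 ≤ t) (y : ℝ) : |relChar t y - y| ≤ t / 2 := by
  unfold relChar
  rw [abs_le]
  constructor <;> nlinarith [ramp_le_one y, neg_one_le_ramp y]

/-- After `t₁` the relative characteristic map has a positive zero. -/
theorem exists_relChar_eq_zero {t : ℝ} (ht : 0 < t) (hT : 1 < t / 2 * (π / (2 * γ))) :
    ∃ a, 0 < a ∧ relChar t a = 0 := by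
  have hs := slope_pos
  have hg := γ_pos
  obtain ⟨b, hb0, hb⟩ : ∃ b, 0 < b ∧ relChar t b < 0 := by
    have hd : HasDerivAt (relChar t) (1 - t / 2 * (π / (2 * γ))) 0 := by
      have h1 : HasDerivAt (fun y : ℝ => y - t / 2 * sin (π / (2 * γ) * y))
          (1 - t / 2 * (cos (π / (2 * γ) * 0) * (π / (2 * γ) * 1))) 0 :=
        (hasDerivAt_id (0 : ℝ)).sub ((((hasDerivAt_id (0 : ℝ)).const_mul _).sin).const_mul _)
      rw [mul_zero, cos_zero, one_mul, mul_one] at h1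
      refine h1.congr_of_eventuallyEq ?_
      filter_upwards [Ioo_mem_nhds (neg_lt_zero.2 hg) hg] with y hy
      rw [relChar, ramp_of_mem hy.1.le hy.2.le]
    have hslope := hd.tendsto_slope_zero_right.eventually (gt_mem_nhds (sub_neg.2 hT))
    obtain ⟨b, hb, hb0⟩ := (hslope.and self_mem_nhdsWithin).exists
    have hb0' : 0 < b := hb0
    refine ⟨b, hb0', ?_⟩
    rw [zero_add, show relChar t 0 = 0 by simp [relChar, ramp_zero], sub_zero, smul_eq_mul] at hb
    by_contra! hc
    have : 0 ≤ b⁻¹ * relChar t b := by positivity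
    linarith
  have hb' : b ≤ t / 2 := by
    unfold relChar at hb
    nlinarith [ramp_le_one b]
  obtain ⟨a, ha, ha0⟩ := intermediate_value_Icc hb' (continuous_relChar t).continuousOn
    (show (0 : ℝ) ∈ Icc _ _ from ⟨hb.le, by unfold relChar; nlinarith [ramp_le_one (t / 2)]⟩)
  exact ⟨a, hb0.trans_le ha.1, ha0⟩

theorem relChar_lt_relChar {t a b : ℝ} (ht : 0 < t) (ha : 0 < a) (hga : 0 ≤ relChar t a)
    (hab : a < b) : relChar t a < relChar t b := by
  have h := mul_ramp_lt ha hab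
  have h1 : 0 < t / 2 * (b * ramp a - a * ramp b) := by apply mul_pos <;> linarith
  have h2 : a * relChar t b - b * relChar t a = t / 2 * (b * ramp a - a * ramp b) := by
    unfold relChar; ring
  nlinarith

/-- The outer branch of the inverse of the relative characteristic map after `t₁`. -/
theorem exists_outer_branch {t : ℝ} (ht : 0 < t) (hT : 1 < t / 2 * (π / (2 * γ))) :
    ∃ Y : ℝ → ℝ, Continuous Y ∧ 0 < ramp (Y 0) ∧ ∀ z, 0 ≤ z → relChar t (Y z) = z := by
  obtain ⟨a, ha, hga⟩ := exists_relChar_eq_zero ht hT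
  -- `relChar t` is kept on `[a, ∞)`, where it increases, and replaced by a translation to the left
  -- of its zero `a`, so that the result is invertible on the whole line.
  let h : ℝ → ℝ := fun y => relChar t (max a y) + (min a y - a)
  have hc : Continuous h := by
    have := continuous_relChar t
    fun_prop
  have hmono : ∀ y z, a ≤ y → y < z → relChar t y < relChar t z := by
    intro y z hy hyz
    rcases hy.eq_or_lt with rfl | hy
    · exact relChar_lt_relChar ht ha hga.ge hyz
    · have := relChar_lt_relChar ht ha hga.ge hy
      exact relChar_lt_relChar ht (ha.trans hy) (by linarith) hyz
  have hm : StrictMono h := by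
    intro y z hyz
    simp only [h]
    rcases le_or_gt a y with hy | hy
    · rw [max_eq_right hy, max_eq_right (by linarith), min_eq_left hy, min_eq_left (by linarith)]
      linarith [hmono y z hy hyz]
    · rw [max_eq_left hy.le, min_eq_right hy.le]
      rcases le_or_gt z a with hz | hz
      · rw [max_eq_left hz, min_eq_right hz]; linarith
      · rw [max_eq_right hz.le, min_eq_left hz.le]
        linarith [hmono a z le_rfl hz]
  have hb : ∀ y, |h y - y| ≤ t / 2 := by
    intro y
    have e : h y - y = relChar t (max a y) - max a y := by
      have := max_add_min a y
      simp only [h]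
      linarith
    rw [e]
    exact abs_relChar_sub_le ht.le _
  obtain ⟨Y, hY, hhY⟩ := exists_continuous_rightInverse hm hc hb
  have hYa : Y 0 = a := by
    refine hm.injective ?_
    rw [hhY]
    simp [h, hga]
  refine ⟨Y, hY, ?_, fun z hz => ?_⟩
  · rw [hYa]
    unfold relChar at hga
    by_contra! hr
    nlinarith
  · have haY : a ≤ Y z := by
      rw [← hYa]
      by_contra! hlt
      have := hm hlt
      rw [hhY, hhY] at this
      linarith
    have := hhY z
    simp only [h, max_eq_right haY, min_eq_left haY] at this
    linarith

/-- The label relation in terms of the relative label `y`. -/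
theorem u0_of_relChar {x₀ t x y : ℝ} (h : relChar t y = x - x₀ - t / 2) :
    u0 x₀ (x₀ + y) = u0 x₀ (x - t * u0 x₀ (x₀ + y)) := by
  congr 1
  rw [u0_eq, add_sub_cancel_left]
  unfold relChar at h
  linarith

theorem exists_smooth_profile (x₀ : ℝ) {t : ℝ} (ht : t ∈ Icc 0 (t1 x₀)) :
    ∃ v : ℝ → ℝ, Continuous v ∧ ∀ x, v x = u0 x₀ (x - t * v x) := by
  have hT : t / 2 * (π / (2 * γ)) ≤ 1 := not_lt.1 fun h => (t1_lt_iff.2 h).not_ge ht.2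
  obtain ⟨Y, hY, hgY⟩ := exists_continuous_rightInverse (relChar_strictMono ht.1 hT)
    (continuous_relChar t) (abs_relChar_sub_le ht.1)
  refine ⟨fun x => u0 x₀ (x₀ + Y (x - x₀ - t / 2)), ?_, fun x => u0_of_relChar (hgY _)⟩
  have := continuous_u0 x₀
  fun_prop

/-- The outer branch gives the right half and its reflection the left half. The symmetry forces `uL
+ uR = 1`, hence shock speed `1 / 2`. -/
theorem exists_shock_profile (x₀ : ℝ) {t : ℝ} (ht : t1 x₀ < t) :
    ∃ v : ℝ → ℝ, ContinuousOn v {x₀ + t / 2}ᶜ ∧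
      (∀ x, x ≠ x₀ + t / 2 → v x = u0 x₀ (x - t * v x)) ∧
      ∃ uL uR : ℝ, Tendsto v (𝓝[<] (x₀ + t / 2)) (𝓝 uL) ∧
        Tendsto v (𝓝[>] (x₀ + t / 2)) (𝓝 uR) ∧ uR < uL ∧ uL + uR = 1 := by
  obtain ⟨Y, hY, hY0, hgY⟩ := exists_outer_branch ((t1_pos x₀).trans ht) (t1_lt_iff.1 ht)
  have hu := continuous_u0 x₀
  let vR : ℝ → ℝ := fun x => u0 x₀ (x₀ + Y (x - x₀ - t / 2))
  let vL : ℝ → ℝ := fun x => u0 x₀ (x₀ + -Y (-(x - x₀ - t / 2)))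
  have hvR : Continuous vR := by fun_prop
  have hvL : Continuous vL := by fun_prop
  let v : ℝ → ℝ := fun x => if x < x₀ + t / 2 then vL x else vR x
  have eL : ∀ x, x < x₀ + t / 2 → v x = vL x := fun x hx => if_pos hx
  have eR : ∀ x, x₀ + t / 2 < x → v x = vR x := fun x hx => if_neg hx.not_gt
  refine ⟨v, ?_, ?_, vL (x₀ + t / 2), vR (x₀ + t / 2), ?_, ?_, ?_, ?_⟩
  · intro x hx
    rcases lt_or_gt_of_ne (hx : x ≠ x₀ + t / 2) with hx | hx
    · refine ContinuousAt.continuousWithinAt (hvL.continuousAt.congr ?_)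
      filter_upwards [Iio_mem_nhds hx] with y hy using (eL y hy).symm
    · refine ContinuousAt.continuousWithinAt (hvR.continuousAt.congr ?_)
      filter_upwards [Ioi_mem_nhds hx] with y hy using (eR y hy).symm
  · intro x hx
    rcases lt_or_gt_of_ne hx with hx | hx
    · rw [eL x hx]
      exact u0_of_relChar (by rw [relChar_neg, hgY _ (by linarith), neg_neg])
    · rw [eR x hx]
      exact u0_of_relChar (hgY _ (by linarith))
  · refine Tendsto.congr' ?_ (tendsto_nhdsWithin_of_tendsto_nhds (hvL.tendsto _))
    filter_upwards [self_mem_nhdsWithin] with y hy using (eL y hy).symm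
  · refine Tendsto.congr' ?_ (tendsto_nhdsWithin_of_tendsto_nhds (hvR.tendsto _))
    filter_upwards [self_mem_nhdsWithin] with y hy using (eR y hy).symm
  · simp only [vL, vR, u0_eq, add_sub_cancel_left, sub_self, neg_zero, ramp_neg]
    linarith
  · simp only [vL, vR, u0_eq, add_sub_cancel_left, sub_self, neg_zero, ramp_neg]
    ring

theorem exists_isShockSolution (x₀ : ℝ) :
    ∃ (u : ℝ → ℝ → ℝ) (xS : ℝ → ℝ), IsShockSolution x₀ u xS := by
  choose! v hv hv' using fun t => exists_smooth_profile x₀ (t := t)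
  choose! w hw hw' uL uR hL hR hlt hsum using fun t => exists_shock_profile x₀ (t := t)
  have e₁ : ∀ t, t ≤ t1 x₀ → (if t ≤ t1 x₀ then v t else w t) = v t := fun t ht => if_pos ht
  have e₂ : ∀ t, t1 x₀ < t → (if t ≤ t1 x₀ then v t else w t) = w t :=
    fun t ht => if_neg ht.not_ge
  refine ⟨fun t => if t ≤ t1 x₀ then v t else w t, fun t => x₀ + t / 2, ?_, ?_, ?_, ?_, ?_⟩
  · intro t ht
    rw [e₁ t ht.2]
    exact hv t ht
  · intro t ht
    rw [e₁ t ht.2]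
    exact hv' t ht
  · intro t ht
    rw [e₂ t ht.1]
    exact hw t ht.1
  · intro t ht
    rw [e₂ t ht.1]
    exact hw' t ht.1
  · intro t ht
    rw [e₂ t ht.1]
    refine ⟨uL t, uR t, hL t ht.1, hR t ht.1, hlt t ht.1, ?_⟩
    have hd : HasDerivAt (fun t => x₀ + t / 2) (1 / 2) t :=
      ((hasDerivAt_id t).div_const 2).const_add x₀
    convert hd using 1
    have h₁ := hlt t ht.1
    have h₂ := hsum t ht.1
    rw [div_eq_iff (by linarith)]
    unfold flux
    linear_combination (1 / 2) * (uL t - uR t) * h₂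

end Burgers

/-! ### From orthogonal second differences to the width bound and sharp convectivity. -/

theorem le_kolmogorovWidth_of_pairwise_orthogonal {E : Type*} [NormedAddCommGroup E]
    [InnerProductSpace ℝ E] {M : Set E} {N : ℕ} (hN : 1 ≤ N) {w : Fin (2 * N) → ℕ → E}
    (hw : ∀ n k, w n k ∈ M) {r : ℝ} (hr : 0 < r)
    (horth : ∀ m n, m ≠ n → inner ℝ (w m 0 - (2 : ℝ) • w m 1 + w m 2)
      (w n 0 - (2 : ℝ) • w n 1 + w n 2) = 0)
    (hnorm : ∀ n, r ≤ ‖w n 0 - (2 : ℝ) • w n 1 + w n 2‖) :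
    ENNReal.ofReal (r / 8) ≤ kolmogorovWidth N M := by
  refine le_iInf fun V => le_iInf fun hV => le_iInf fun hfin => ?_
  by_contra! hlt
  have happrox : ∀ x ∈ M, ∃ v ∈ V, ‖x - v‖ < r / 8 := by
    intro x hx
    have h1 : ⨅ v ∈ V, ‖x - v‖ₑ < ENNReal.ofReal (r / 8) :=
      (le_iSup₂ (f := fun x (_ : x ∈ M) => ⨅ v ∈ V, ‖x - v‖ₑ) x hx).trans_lt hlt
    simp only [iInf_lt_iff] at h1
    obtain ⟨v, hv, h2⟩ := h1
    refine ⟨v, hv, ?_⟩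
    rwa [← ofReal_norm, ENNReal.ofReal_lt_ofReal_iff (by positivity)] at h2
  set ψ : Fin (2 * N) → E := fun n => w n 0 - (2 : ℝ) • w n 1 + w n 2
  have hpos : ∀ n, 0 < ‖ψ n‖ := fun n => hr.trans_le (hnorm n)
  let e : Fin (2 * N) → E := fun n => (‖ψ n‖⁻¹ : ℝ) • ψ n
  have he : Orthonormal ℝ e := by
    constructor
    · intro n
      simp only [e, norm_smul, norm_inv, norm_norm]
      exact inv_mul_cancel₀ (hpos n).ne'
    · intro m n hmn
      simp only [e, inner_smul_left, inner_smul_right]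
      rw [horth m n hmn]
      simp
  have hclose : ∀ n, ∃ v ∈ V, ‖e n - v‖ < 1 / 2 := by
    intro n
    obtain ⟨v₀, hv₀, h₀⟩ := happrox _ (hw n 0)
    obtain ⟨v₁, hv₁, h₁⟩ := happrox _ (hw n 1)
    obtain ⟨v₂, hv₂, h₂⟩ := happrox _ (hw n 2)
    refine ⟨(‖ψ n‖⁻¹ : ℝ) • (v₀ - (2 : ℝ) • v₁ + v₂), V.smul_mem _
      (V.add_mem (V.sub_mem hv₀ (V.smul_mem _ hv₁)) hv₂), ?_⟩
    -- The weights `1, 2, 1` turn three errors below `r / 8` into one below `r / 2`.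
    have h3 : ‖ψ n - (v₀ - (2 : ℝ) • v₁ + v₂)‖ < r / 2 := by
      have e1 : ψ n - (v₀ - (2 : ℝ) • v₁ + v₂) =
          (w n 0 - v₀) - (2 : ℝ) • (w n 1 - v₁) + (w n 2 - v₂) := by
        simp only [ψ]; module
      rw [e1]
      have h4 : ‖(2 : ℝ) • (w n 1 - v₁)‖ = 2 * ‖w n 1 - v₁‖ := by
        rw [norm_smul]; norm_num
      have h5 := norm_add_le ((w n 0 - v₀) - (2 : ℝ) • (w n 1 - v₁)) (w n 2 - v₂)
      have h6 := norm_sub_le (w n 0 - v₀) ((2 : ℝ) • (w n 1 - v₁))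
      linarith
    simp only [e]
    rw [← smul_sub, norm_smul, norm_inv, norm_norm, inv_mul_lt_iff₀ (hpos n)]
    have := hnorm n
    change r ≤ ‖ψ n‖ at this
    linarith
  let b := stdOrthonormalBasis ℝ V
  -- A unit vector within `1 / 2` of `V` has a projection onto `V` of squared norm above `1 - 1 /
  -- 4`. Summed over `2N` vectors this is at least `3N / 2`, whereas Bessel's inequality for each of
  -- the `N` basis vectors of `V` allows at most `N`.
  have hlow : ∀ n, 3 / 4 < ∑ j, (inner ℝ (b j : E) (e n)) ^ 2 := by
    intro n
    obtain ⟨v, hv, hlt⟩ := hclose n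
    have hv' : v = ∑ j, inner ℝ (b j : E) v • (b j : E) := by
      have := congrArg (Subtype.val) (b.sum_repr' ⟨v, hv⟩)
      simpa using this.symm
    have h1 : inner ℝ (e n) v = ∑ j, inner ℝ (b j : E) v * inner ℝ (b j : E) (e n) := by
      conv_lhs => rw [hv', inner_sum]
      refine Finset.sum_congr rfl fun j _ => ?_
      rw [inner_smul_right, real_inner_comm (e n)]
    have h2 : ‖v‖ ^ 2 = ∑ j, (inner ℝ (b j : E) v) ^ 2 := by
      have := b.sum_sq_norm_inner_right ⟨v, hv⟩
      simpa using this.symm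
    have h3 : ‖e n - v‖ ^ 2 < 1 / 4 := by
      have := norm_nonneg (e n - v)
      nlinarith
    rw [norm_sub_sq_real, he.1 n, h1, h2] at h3
    have h4 : 0 ≤ ∑ j, (inner ℝ (b j : E) v - inner ℝ (b j : E) (e n)) ^ 2 :=
      Finset.sum_nonneg fun j _ => sq_nonneg _
    have h5 : ∑ j, (inner ℝ (b j : E) v - inner ℝ (b j : E) (e n)) ^ 2 =
        ∑ j, (inner ℝ (b j : E) v) ^ 2 - 2 * ∑ j, inner ℝ (b j : E) v * inner ℝ (b j : E) (e n) +
        ∑ j, (inner ℝ (b j : E) (e n)) ^ 2 := by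
      rw [Finset.mul_sum, ← Finset.sum_sub_distrib, ← Finset.sum_add_distrib]
      exact Finset.sum_congr rfl fun j _ => by ring
    linarith
  have hup : ∑ n, ∑ j, (inner ℝ (b j : E) (e n)) ^ 2 ≤ N := by
    rw [Finset.sum_comm]
    calc ∑ j, ∑ n, (inner ℝ (b j : E) (e n)) ^ 2 ≤ ∑ j : Fin (Module.finrank ℝ V), (1 : ℝ) := by
          refine Finset.sum_le_sum fun j _ => ?_
          have h1 := he.sum_inner_products_le (b j : E) (s := Finset.univ)
          have h2 : ‖(b j : E)‖ = 1 := b.orthonormal.1 j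
          rw [h2, one_pow] at h1
          refine (Finset.sum_congr rfl fun n _ => ?_).trans_le h1
          rw [real_inner_comm, Real.norm_eq_abs, sq_abs]
      _ = N := by simp [hfin]
  have hlow' : ∑ _n : Fin (2 * N), (3 / 4 : ℝ) ≤ ∑ n, ∑ j, (inner ℝ (b j : E) (e n)) ^ 2 :=
    Finset.sum_le_sum fun n _ => (hlow n).le
  rw [Finset.sum_const, Finset.card_univ, Fintype.card_fin, nsmul_eq_mul] at hlow'
  push_cast at hlow'
  have : (1 : ℝ) ≤ N := by exact_mod_cast hN
  linarith

/-- For coefficients that do not depend on the index of the ball and vanish from some index on,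
the ball constant is bounded uniformly in `N`. -/
theorem exists_ballConstant_le {p : ℝ} (hp : 1 ≤ p) {a : ℕ → ℝ} {K : ℕ}
    (ha : ∀ k, K ≤ k → a k = 0) :
    ∃ C : ℝ, ∀ N : ℕ, ballConstant p (fun _ : Fin (2 * N) => a) ≤ ENNReal.ofReal C := by
  by_cases h1 : p = 1
  · refine ⟨(∑' k, ENNReal.ofReal |a k|).toReal, fun N => ?_⟩
    rw [ENNReal.ofReal_toReal]
    · rw [ballConstant, if_pos h1]
      exact iSup_le fun _ => le_rfl
    · rw [tsum_eq_sum (s := Finset.range K)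
        fun k hk => by rw [ha k (by simpa using hk)]; simp]
      exact ENNReal.sum_ne_top.2 fun _ _ => ENNReal.ofReal_ne_top
  · refine ⟨((∑' k : ℕ, ENNReal.ofReal (((k : ℝ) + 1) ^ p * |a k| ^ p)) ^ (1 / p)).toReal,
      fun N => ?_⟩
    rw [ENNReal.ofReal_toReal]
    · rw [ballConstant, if_neg h1]
      exact iSup_le fun _ => le_rfl
    · refine ENNReal.rpow_ne_top_of_nonneg (by positivity) ?_
      rw [tsum_eq_sum (s := Finset.range K) fun k hk => by
        rw [ha k (by simpa using hk), abs_zero, Real.zero_rpow (by linarith)]; simp]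
      exact ENNReal.sum_ne_top.2 fun _ _ => ENNReal.ofReal_ne_top

theorem isSharplyConvective_of_second_differences {E : Type*} [NormedAddCommGroup E]
    [InnerProductSpace ℝ E] {M : Set E} {α c : ℝ} (hc : 0 < c)
    (h : ∀ N : ℕ, 1 ≤ N → ∃ w : Fin (2 * N) → ℕ → E, (∀ n k, w n k ∈ M) ∧
      (∀ m n, m ≠ n → inner ℝ (w m 0 - (2 : ℝ) • w m 1 + w m 2)
        (w n 0 - (2 : ℝ) • w n 1 + w n 2) = 0) ∧
      ∀ n, c * (N : ℝ) ^ (-α) ≤ ‖w n 0 - (2 : ℝ) • w n 1 + w n 2‖) :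
    IsSharplyConvective M α := by
  intro p hp
  -- The second differences serve as both balls: `a` forms them from `M`, and `b` reproduces each
  -- from itself.
  let a : ℕ → ℝ := fun k => if k = 0 then 1 else if k = 1 then -2 else if k = 2 then 1 else 0
  let b : ℕ → ℝ := fun k => if k = 0 then 1 else 0
  have ha : ∀ k, 3 ≤ k → a k = 0 := fun k hk => by
    simp only [a]; rw [if_neg (by omega), if_neg (by omega), if_neg (by omega)]
  have hb : ∀ k, 1 ≤ k → b k = 0 := fun k hk => if_neg (by omega)
  obtain ⟨C₁, hC₁⟩ := exists_ballConstant_le hp ha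
  obtain ⟨C₂, hC₂⟩ := exists_ballConstant_le hp hb
  refine ⟨max C₁ C₂, c, hc, fun N hN => ?_⟩
  obtain ⟨w, hw, horth, hnorm⟩ := h N hN
  let ψ : Fin (2 * N) → E := fun n => w n 0 - (2 : ℝ) • w n 1 + w n 2
  have hN0 : (0 : ℝ) < N := by exact_mod_cast hN
  have hne : ∀ n, ψ n ≠ 0 := fun n =>
    norm_pos_iff.1 (lt_of_lt_of_le (mul_pos hc (Real.rpow_pos_of_pos hN0 _)) (hnorm n))
  have hli : LinearIndependent ℝ ψ :=
    linearIndependent_of_ne_zero_of_inner_eq_zero hne fun m n hmn => horth m n hmn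
  refine ⟨ψ, fun _ => a, ψ, fun _ => b, ⟨hli, w, hw, fun n => ?_⟩,
    (hC₁ N).trans (ENNReal.ofReal_le_ofReal (le_max_left _ _)),
    ⟨hli, fun n _ => ψ n, fun n _ => mem_range_self n, fun n => ?_⟩,
    (hC₂ N).trans (ENNReal.ofReal_le_ofReal (le_max_right _ _)), horth, hnorm⟩
  · have hs := hasSum_sum_of_ne_finset_zero (f := fun k => a k • w n k) (s := Finset.range 3)
      (L := SummationFilter.unconditional ℕ)
      fun k hk => by rw [ha k (by simpa using hk), zero_smul]
    have e : ∑ k ∈ Finset.range 3, a k • w n k = ψ n := by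
      simp only [Finset.sum_range_succ, Finset.sum_range_zero, a, ψ]
      norm_num
      module
    rwa [e] at hs
  · have hs := hasSum_sum_of_ne_finset_zero (f := fun k => b k • ψ n) (s := Finset.range 1)
      (L := SummationFilter.unconditional ℕ)
      fun k hk => by rw [hb k (by simp at hk; omega), zero_smul]
    have e : ∑ k ∈ Finset.range 1, b k • ψ n = ψ n := by simp [b]
    rwa [e] at hs

namespace Burgers

/-! ### Second differences of the truncated identity and their norms. -/

/-- The second difference with step `δ` of the truncation level of the identity. -/
noncomputable def truncDiff (δ τ y : ℝ) : ℝ :=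
  max (-(τ + δ)) (min (τ + δ) y) - 2 * max (-τ) (min τ y) + max (-(τ - δ)) (min (τ - δ) y)

theorem truncDiff_neg {δ τ : ℝ} (hδ : 0 ≤ δ) (h : δ ≤ τ) (y : ℝ) :
    truncDiff δ τ (-y) = -truncDiff δ τ y := by
  have key : ∀ s : ℝ, 0 ≤ s → max (-s) (min s (-y)) = -max (-s) (min s y) := by
    intro s hs
    rcases max_cases (-s) (min s y) with h | h <;>
    rcases max_cases (-s) (min s (-y)) with h' | h' <;>
    rcases min_cases s y with h'' | h'' <;>
    rcases min_cases s (-y) with h''' | h''' <;> linarith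
  unfold truncDiff
  rw [key _ (by linarith), key _ (by linarith), key _ (by linarith)]
  ring

theorem truncDiff_eq_zero {δ τ y : ℝ} (hδ : 0 ≤ δ) (h : δ ≤ τ)
    (hy : |y| ≤ τ - δ ∨ τ + δ ≤ |y|) : truncDiff δ τ y = 0 := by
  wlog hy0 : 0 ≤ y generalizing y
  · have := this (y := -y) (by rwa [abs_neg]) (by linarith)
    rw [truncDiff_neg hδ h] at this
    linarith
  rw [abs_of_nonneg hy0] at hy
  unfold truncDiff
  rcases hy with hy | hy
  · rw [min_eq_right (by linarith), min_eq_right (by linarith), min_eq_right hy,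
      max_eq_right (by linarith), max_eq_right (by linarith), max_eq_right (by linarith)]
    ring
  · rw [min_eq_left hy, min_eq_left (by linarith), min_eq_left (by linarith),
      max_eq_right (by linarith), max_eq_right (by linarith), max_eq_right (by linarith)]
    ring

/-- Near `|y| = τ` the absolute value is a tent of height `δ` and half-width `δ`, so it is at least
half its height on the middle half. -/
theorem le_abs_truncDiff {δ τ y : ℝ} (hδ : 0 ≤ δ) (h : δ ≤ τ)
    (h₁ : τ - δ / 2 ≤ |y|) (h₂ : |y| ≤ τ + δ / 2) : δ / 2 ≤ |truncDiff δ τ y| := by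
  wlog hy0 : 0 ≤ y generalizing y
  · have := this (y := -y) (by rwa [abs_neg]) (by rwa [abs_neg]) (by linarith)
    rwa [truncDiff_neg hδ h, abs_neg] at this
  rw [abs_of_nonneg hy0] at h₁ h₂
  refine le_trans ?_ (neg_le_abs _)
  unfold truncDiff
  rw [min_eq_right (by linarith : y ≤ τ + δ), min_eq_left (by linarith : τ - δ ≤ y),
    max_eq_right (by linarith : -(τ + δ) ≤ y), max_eq_right (by linarith : -(τ - δ) ≤ τ - δ)]
  rcases le_total y τ with hy | hy
  · rw [min_eq_right hy, max_eq_right (by linarith)]; linarith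
  · rw [min_eq_left hy, max_eq_right (by linarith)]; linarith

theorem continuous_truncDiff (δ τ : ℝ) : Continuous (truncDiff δ τ) := by
  unfold truncDiff; fun_prop

theorem memLp_of_continuous {f : ℝ → ℝ} (hf : Continuous f) :
    MemLp f 2 (volume.restrict (Ioo (0 : ℝ) 1)) := by
  obtain ⟨C, hC⟩ := isCompact_Icc.exists_bound_of_continuousOn (hf.continuousOn (s := Icc 0 1))
  exact MemLp.of_bound hf.aestronglyMeasurable C
    (ae_restrict_of_forall_mem measurableSet_Ioo fun x hx => hC x (Ioo_subset_Icc_self hx))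

theorem continuous_kink (x₀ τ : ℝ) :
    Continuous fun x => x + τ - max (-τ) (min τ (x - x₀)) := by fun_prop

/-- The class in `L²(0, 1)` of a late characteristic map. -/
noncomputable def kink (x₀ τ : ℝ) : L2 := (memLp_of_continuous (continuous_kink x₀ τ)).toLp _

theorem kink_mem_charFamily {x₀ : ℝ} {u : ℝ → ℝ → ℝ} {xS : ℝ → ℝ} (h : IsShockSolution x₀ u xS)
    {τ : ℝ} (h₁ : 1 / 5 ≤ τ) (h₂ : τ < 3 / 2) : kink x₀ τ ∈ charFamily x₀ xS := by
  refine ⟨2 * τ, ⟨by linarith, by unfold tF; linarith⟩, ?_⟩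
  filter_upwards [(memLp_of_continuous (continuous_kink x₀ τ)).coeFn_toLp] with x hx
  rw [h.X_eq h₁ h₂]
  exact hx

theorem kink_second_difference (x₀ δ τ : ℝ) :
    kink x₀ (τ - δ) - (2 : ℝ) • kink x₀ τ + kink x₀ (τ + δ) =ᵐ[volume.restrict (Ioo (0 : ℝ) 1)]
      fun x => -truncDiff δ τ (x - x₀) := by
  have h (τ : ℝ) := (memLp_of_continuous (continuous_kink x₀ τ)).coeFn_toLp
  filter_upwards [h (τ - δ), h τ, h (τ + δ),
    Lp.coeFn_add (kink x₀ (τ - δ) - (2 : ℝ) • kink x₀ τ) (kink x₀ (τ + δ)),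
    Lp.coeFn_sub (kink x₀ (τ - δ)) ((2 : ℝ) • kink x₀ τ),
    Lp.coeFn_smul (2 : ℝ) (kink x₀ τ)] with x h1 h2 h3 h4 h5 h6
  change kink x₀ (τ - δ) x = _ at h1
  change kink x₀ τ x = _ at h2
  change kink x₀ (τ + δ) x = _ at h3
  rw [h4, Pi.add_apply, h5, Pi.sub_apply, h6, Pi.smul_apply, h1, h2, h3, smul_eq_mul, truncDiff]
  ring

theorem inner_kink_second_difference (x₀ δ τ σ : ℝ) :
    inner ℝ (kink x₀ (τ - δ) - (2 : ℝ) • kink x₀ τ + kink x₀ (τ + δ))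
      (kink x₀ (σ - δ) - (2 : ℝ) • kink x₀ σ + kink x₀ (σ + δ)) =
    ∫ x in Ioo (0 : ℝ) 1, truncDiff δ τ (x - x₀) * truncDiff δ σ (x - x₀) := by
  rw [L2.inner_def]
  refine integral_congr_ae ?_
  filter_upwards [kink_second_difference x₀ δ τ, kink_second_difference x₀ δ σ] with x h1 h2
  rw [h1, h2]
  simp [mul_comm]

theorem inner_kink_eq_zero (x₀ : ℝ) {δ τ σ : ℝ} (hδ : 0 ≤ δ) (hτ : δ ≤ τ)
    (h : τ + δ ≤ σ - δ) :
    inner ℝ (kink x₀ (τ - δ) - (2 : ℝ) • kink x₀ τ + kink x₀ (τ + δ))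
      (kink x₀ (σ - δ) - (2 : ℝ) • kink x₀ σ + kink x₀ (σ + δ)) = 0 := by
  rw [inner_kink_second_difference]
  have : ∀ x, truncDiff δ τ (x - x₀) * truncDiff δ σ (x - x₀) = 0 := by
    intro x
    rcases le_total (|x - x₀|) (σ - δ) with hx | hx
    · rw [truncDiff_eq_zero (τ := σ) hδ (by linarith) (Or.inl hx), mul_zero]
    · rw [truncDiff_eq_zero (τ := τ) hδ hτ (Or.inr (by linarith)), zero_mul]
  simp [this]

theorem le_norm_sq_kink {x₀ δ τ : ℝ} (hx₀ : x₀ ∈ Ioo (0 : ℝ) 1) (hδ : 0 ≤ δ) (hτ : δ ≤ τ)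
    (hτ' : τ + δ / 2 < 1 / 2) :
    (δ / 2) ^ 2 * δ ≤
      ‖kink x₀ (τ - δ) - (2 : ℝ) • kink x₀ τ + kink x₀ (τ + δ)‖ ^ 2 := by
  rw [← real_inner_self_eq_norm_sq, inner_kink_second_difference]
  obtain ⟨q, hq, hq'⟩ : ∃ q, Icc q (q + δ) ⊆ Ioo (0 : ℝ) 1 ∧
      ∀ x ∈ Icc q (q + δ), τ - δ / 2 ≤ |x - x₀| ∧ |x - x₀| ≤ τ + δ / 2 := by
    -- Only one of the two tents needs to lie in `(0, 1)`: the one on the longer side of `x₀`, where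
    -- `τ + δ / 2 < 1 / 2` leaves room for its middle half.
    rcases le_total x₀ (1 / 2) with h | h
    · refine ⟨x₀ + τ - δ / 2, fun x hx => ⟨?_, ?_⟩, fun x hx => ?_⟩
      · linarith [hx.1, hx₀.1]
      · linarith [hx.2]
      · rw [abs_of_nonneg (by linarith [hx.1])]
        constructor <;> linarith [hx.1, hx.2]
    · refine ⟨x₀ - τ - δ / 2, fun x hx => ⟨?_, ?_⟩, fun x hx => ?_⟩
      · linarith [hx.1]
      · linarith [hx.2, hx₀.2]
      · rw [abs_of_nonpos (by linarith [hx.2])]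
        constructor <;> linarith [hx.1, hx.2]
  have hc : Continuous fun x => truncDiff δ τ (x - x₀) * truncDiff δ τ (x - x₀) := by
    have := continuous_truncDiff δ τ
    fun_prop
  have hint : IntegrableOn (fun x => truncDiff δ τ (x - x₀) * truncDiff δ τ (x - x₀))
      (Ioo (0 : ℝ) 1) := (hc.integrableOn_Icc (a := 0) (b := 1)).mono_set Ioo_subset_Icc_self
  calc (δ / 2) ^ 2 * δ = ∫ _ in Icc q (q + δ), (δ / 2) ^ 2 := by
        rw [setIntegral_const, smul_eq_mul, Real.volume_real_Icc_of_le (by linarith)]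
        ring
    _ ≤ ∫ x in Icc q (q + δ), truncDiff δ τ (x - x₀) * truncDiff δ τ (x - x₀) := by
        refine setIntegral_mono_on (by simp) (hint.mono_set hq) measurableSet_Icc fun x hx => ?_
        rw [← pow_two, ← sq_abs (truncDiff _ _ _)]
        exact pow_le_pow_left₀ (by positivity)
          (le_abs_truncDiff hδ hτ (hq' x hx).1 (hq' x hx).2) 2
    _ ≤ _ := setIntegral_mono_set hint
        (Eventually.of_forall fun x => mul_self_nonneg _) hq.eventuallyLE

theorem exists_orthogonal_second_differences {x₀ : ℝ} (hx₀ : x₀ ∈ Ioo (0 : ℝ) 1)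
    {u : ℝ → ℝ → ℝ} {xS : ℝ → ℝ} (h : IsShockSolution x₀ u xS) (N : ℕ) (hN : 1 ≤ N) :
    ∃ w : Fin (2 * N) → ℕ → L2, (∀ n k, w n k ∈ charFamily x₀ xS) ∧
      (∀ m n, m ≠ n → inner ℝ (w m 0 - (2 : ℝ) • w m 1 + w m 2)
        (w n 0 - (2 : ℝ) • w n 1 + w n 2) = 0) ∧
      ∀ n, 1 / 128 * (N : ℝ) ^ (-(3 / 2) : ℝ) ≤ ‖w n 0 - (2 : ℝ) • w n 1 + w n 2‖ := by
  have hN1 : (1 : ℝ) ≤ N := by exact_mod_cast hN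
  have hN0 : (0 : ℝ) < N := by linarith
  -- The `2N` supports of width `2 * δ` in `|x - x₀|` fill an interval of length `4 * N * δ = 1 /
  -- 4`, from `1 / 5` to `9 / 20 < 1 / 2`. The constant `1 / 128` comes from `δ ^ 3 / 4 = (1 / 128)
  -- ^ 2 / N ^ 3`.
  set δ : ℝ := 1 / (16 * N) with hδ
  have hδN : δ * N = 1 / 16 := by rw [hδ]; field_simp
  have hδ0 : 0 < δ := by positivity
  have hδ1 : δ ≤ 1 / 16 := by nlinarith
  let τ : ℕ → ℝ := fun n => 1 / 5 + (2 * n + 1) * δ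
  have hτ : ∀ n : ℕ, 1 / 5 + δ ≤ τ n := fun n => by
    have : (0 : ℝ) ≤ n * δ := by positivity
    simp only [τ]; linarith
  have hτ' : ∀ n : ℕ, n < 2 * N → τ n + δ ≤ 9 / 20 := fun n hn => by
    have h1 : (n : ℝ) + 1 ≤ 2 * N := by exact_mod_cast hn
    have := mul_le_mul_of_nonneg_right h1 hδ0.le
    simp only [τ]; linarith
  have hsep : ∀ m n : ℕ, m < n → τ m + δ ≤ τ n - δ := fun m n hmn => by
    have h1 : (m : ℝ) + 1 ≤ n := by exact_mod_cast hmn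
    have := mul_le_mul_of_nonneg_right h1 hδ0.le
    simp only [τ]; linarith
  let w : Fin (2 * N) → ℕ → L2 := fun n k =>
    if k = 0 then kink x₀ (τ n - δ) else if k = 1 then kink x₀ (τ n) else kink x₀ (τ n + δ)
  refine ⟨w, fun n k => ?_, fun m n hmn => ?_, fun n => ?_⟩
  · have h1 := hτ n
    have h2 := hτ' n n.2
    simp only [w]
    split_ifs <;> exact kink_mem_charFamily h (by linarith) (by linarith)
  · change inner ℝ (kink x₀ (τ m - δ) - (2 : ℝ) • kink x₀ (τ m) + kink x₀ (τ m + δ))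
      (kink x₀ (τ n - δ) - (2 : ℝ) • kink x₀ (τ n) + kink x₀ (τ n + δ)) = 0
    rcases lt_or_gt_of_ne (Fin.val_ne_of_ne hmn) with hlt | hlt
    · exact inner_kink_eq_zero x₀ hδ0.le (by linarith [hτ m]) (hsep _ _ hlt)
    · rw [real_inner_comm]
      exact inner_kink_eq_zero x₀ hδ0.le (by linarith [hτ n]) (hsep _ _ hlt)
  · change _ ≤ ‖kink x₀ (τ n - δ) - (2 : ℝ) • kink x₀ (τ n) + kink x₀ (τ n + δ)‖
    have hle := le_norm_sq_kink hx₀ hδ0.le (by linarith [hτ n]) (by linarith [hτ' n n.2] :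
      τ n + δ / 2 < 1 / 2)
    refine le_of_sq_le_sq (le_trans (le_of_eq ?_) hle) (norm_nonneg _)
    rw [mul_pow, ← rpow_natCast ((N : ℝ) ^ (-(3 / 2) : ℝ)) 2, ← rpow_mul hN0.le,
      show (-(3 / 2) : ℝ) * (2 : ℕ) = -(3 : ℕ) by norm_num, rpow_neg hN0.le, rpow_natCast, hδ]
    field_simp
    norm_num

end Burgers

theorem mainTheorem5 (x₀ : ℝ) (hx₀ : x₀ ∈ Set.Ioo (0 : ℝ) 1) :
    (∃ (u : ℝ → ℝ → ℝ) (xS : ℝ → ℝ), Burgers.IsShockSolution x₀ u xS) ∧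
    ∀ (u : ℝ → ℝ → ℝ) (xS : ℝ → ℝ), Burgers.IsShockSolution x₀ u xS →
      (∃ c : ℝ, 0 < c ∧ ∀ N : ℕ, 1 ≤ N →
        ENNReal.ofReal (c * (N : ℝ) ^ (-(3 / 2) : ℝ)) ≤
          kolmogorovWidth N (Burgers.charFamily x₀ xS)) ∧
      IsSharplyConvective (Burgers.charFamily x₀ xS) (3 / 2) := by
  refine ⟨Burgers.exists_isShockSolution x₀, fun u xS h => ⟨⟨1 / 1024, by norm_num,
    fun N hN => ?_⟩, isSharplyConvective_of_second_differences (by norm_num)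
      (Burgers.exists_orthogonal_second_differences hx₀ h)⟩⟩
  obtain ⟨w, hw, horth, hnorm⟩ := Burgers.exists_orthogonal_second_differences hx₀ h N hN
  have hN0 : (0 : ℝ) < N := by exact_mod_cast hN
  have := le_kolmogorovWidth_of_pairwise_orthogonal hN hw (by positivity) horth hnorm
  convert this using 2
  ring
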